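/- Let $n\ge 2$, and let $\mathbb H^n$ be $n$-dimensional hyperbolic space with distance $d$. A convex body is a compact geodesically convex set $K\subset\mathbb H^n$ with non-empty interior. Its inradius $r(K)$ is the largest radius of a closed ball contained in $K$. A supporting hyperplane of $K$ is a hyperbolic hyperplane $H$ that meets $K$ and has $K$ in one of the two closed half-spaces bounded by $H$. The Lassak width of $K$ with respect to $H$ is $\max_{x\in K} d(x,H)$, and the minimal Lassak width $w(K)$ is the minimum of the Lassak widths of $K$ over all supporting hyperplanes $H$ of $K$. Then, for every real number $w>0$, $$ \inf\left\{r(K)\colon K\subset \mathbb H^n\text{ convex body, } w(K)\ge w\right\}=0 . $$ -/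

import Mathlib

noncomputable section

namespace PoincareBall

/-- Hyperbolic `n`-space in the Poincaré ball model: the open Euclidean unit ball of `ℝⁿ`.
Its topology is the subspace topology, which is also the topology of the hyperbolic distance. -/
abbrev Hyp (n : ℕ) : Type := {x : EuclideanSpace ℝ (Fin n) // ‖x‖ < 1}

variable {n : ℕ}

/-- The hyperbolic distance
`d(p, q) = arcosh (1 + 2‖p - q‖² / ((1 - ‖p‖²)(1 - ‖q‖²)))`. The (Euclidean) `dist` that the
subtype inherits is never used below. -/
def hdist (p q : Hyp n) : ℝ :=
  Real.arcosh (1 + 2 * ‖p.1 - q.1‖ ^ 2 / ((1 - ‖p.1‖ ^ 2) * (1 - ‖q.1‖ ^ 2)))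

/-- The closed hyperbolic ball `B(p, r)`. -/
def hball (p : Hyp n) (r : ℝ) : Set (Hyp n) := {q | hdist p q ≤ r}

/-- The geodesic segment `[x, y]`: the points lying metrically between `x` and `y`. (Any two points
of hyperbolic space are joined by a unique geodesic segment, and it consists of these points.) -/
def hsegment (x y : Hyp n) : Set (Hyp n) := {z | hdist x z + hdist z y = hdist x y}

/-- `X` contains the geodesic segment between any two of its points. -/
def HConvex (X : Set (Hyp n)) : Prop := ∀ x ∈ X, ∀ y ∈ X, hsegment x y ⊆ X

/-- Convex bodies: compact convex sets with non-empty interior. -/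
structure IsConvexBody (K : Set (Hyp n)) : Prop where
  isCompact : IsCompact K
  convex : HConvex K
  interior_nonempty : (interior K).Nonempty

/-- The hyperbolic hyperplane cut out by the linear hyperplane `u^⊥` (used with `u ≠ 0`). -/
def linHyperplane (u : EuclideanSpace ℝ (Fin n)) : Set (Hyp n) := {x | inner ℝ u x.1 = 0}

/-- The part of the ball on the Euclidean sphere with centre `c` and radius `r` (used for spheres
orthogonal to the unit sphere, that is, for `r > 0` and `‖c‖² = 1 + r²`). -/
def sphHyperplane (c : EuclideanSpace ℝ (Fin n)) (r : ℝ) : Set (Hyp n) := {x | ‖x.1 - c‖ = r}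

/-- `P` is one of the two closed half-spaces bounded by the hyperbolic hyperplane `H`. -/
def IsHalfSpaceOf (H P : Set (Hyp n)) : Prop :=
  (∃ u : EuclideanSpace ℝ (Fin n), u ≠ 0 ∧ H = linHyperplane u ∧
    (P = {x | inner ℝ u x.1 ≤ 0} ∨ P = {x | 0 ≤ inner ℝ u x.1})) ∨
  (∃ (c : EuclideanSpace ℝ (Fin n)) (r : ℝ), 0 < r ∧ ‖c‖ ^ 2 = 1 + r ^ 2 ∧
    H = sphHyperplane c r ∧ (P = {x | ‖x.1 - c‖ ≤ r} ∨ P = {x | r ≤ ‖x.1 - c‖}))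

/-- Hyperbolic hyperplanes: intersections of the open unit ball with a Euclidean hyperplane through
the origin, or with a Euclidean sphere orthogonal to the unit sphere. -/
def IsHyperplane (H : Set (Hyp n)) : Prop :=
  (∃ u : EuclideanSpace ℝ (Fin n), u ≠ 0 ∧ H = linHyperplane u) ∨
  (∃ (c : EuclideanSpace ℝ (Fin n)) (r : ℝ), 0 < r ∧ ‖c‖ ^ 2 = 1 + r ^ 2 ∧ H = sphHyperplane c r)

/-- `H` is a supporting hyperplane of `K`: a hyperplane that meets `K` and has `K` in one of the
closed half-spaces that it bounds. -/
def IsSupporting (H K : Set (Hyp n)) : Prop :=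
  IsHyperplane H ∧ (H ∩ K).Nonempty ∧ ∃ P, IsHalfSpaceOf H P ∧ K ⊆ P

/-- The hyperbolic distance of a point from a set. -/
def hdistSet (x : Hyp n) (H : Set (Hyp n)) : ℝ := sInf {t | ∃ y ∈ H, t = hdist x y}

/-- The Lassak width of `K` with respect to `H`: the maximal distance of the points of `K`
from `H`. -/
def lassakWidth (K H : Set (Hyp n)) : ℝ := sSup {t | ∃ x ∈ K, t = hdistSet x H}

/-- The minimal Lassak width `w(K)`: the minimum of the Lassak widths of `K` with respect to its
supporting hyperplanes. -/
def minLassakWidth (K : Set (Hyp n)) : ℝ :=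
  sInf {t | ∃ H, IsSupporting H K ∧ t = lassakWidth K H}

/-- The inradius `r(K)`: the largest radius of a ball contained in `K`. -/
def inradius (K : Set (Hyp n)) : ℝ := sSup {r | 0 < r ∧ ∃ p, hball p r ⊆ K}

end PoincareBall

end

/-! Fix `δ > 0` and a point `p` on a hyperplane, and consider the part within distance `L` of `p` of
the `δ`-neighbourhood of the hyperplane. A ball in it has radius at most `δ`, but its minimal Lassak
width tends to infinity with `L`, by the following estimate.

In the hyperboloid model a supporting hyperplane is `ν^⊥` with `⟨ν, x⟩ ≥ 0` on the body. As the body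
contains the `δ`-ball about `p`, `⟨ν, p⟩` is at least a positive multiple of `√(-⟨ν, ν⟩)` that
depends only on `δ`. The body also contains two points `q₁`, `q₂` at distance `L` from `p` with
midpoint `p`, so that `q₁ + q₂ = (2 * cosh L) • p`, and one of them satisfies
`⟨ν, q⟩ ≥ cosh L * ⟨ν, p⟩`. Finally, `⟨ν, q⟩ = √(-⟨ν, ν⟩) * sinh d(q, ν^⊥)`.
-/

noncomputable section

namespace PoincareBall

section Minkowski

variable {E : Type*} [NormedAddCommGroup E] [InnerProductSpace ℝ E]

/-- The Minkowski form on `ℝ × E`. The sign is chosen so that the hyperboloid is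
`{x | minkowski x x = 1 ∧ 0 < x.1}`; normal vectors of hyperplanes then have negative square. -/
def minkowski : LinearMap.BilinForm ℝ (ℝ × E) :=
  LinearMap.mk₂ ℝ (fun x y => x.1 * y.1 - inner ℝ x.2 y.2)
    (fun x y z => by simp only [Prod.fst_add, Prod.snd_add, inner_add_left]; ring)
    (fun c x y => by
      simp only [Prod.smul_fst, Prod.smul_snd, real_inner_smul_left, smul_eq_mul]; ring)
    (fun x y z => by simp only [Prod.fst_add, Prod.snd_add, inner_add_right]; ring)
    (fun c x y => by
      simp only [Prod.smul_fst, Prod.smul_snd, real_inner_smul_right, smul_eq_mul]; ring)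

lemma minkowski_apply (x y : ℝ × E) : minkowski x y = x.1 * y.1 - inner ℝ x.2 y.2 := rfl

lemma minkowski_comm (x y : ℝ × E) : minkowski x y = minkowski y x := by
  rw [minkowski_apply, minkowski_apply, mul_comm, real_inner_comm]

lemma minkowski_self (x : ℝ × E) : minkowski x x = x.1 ^ 2 - ‖x.2‖ ^ 2 := by
  rw [minkowski_apply, real_inner_self_eq_norm_sq, ← sq]

lemma minkowski_neg_neg (x : ℝ × E) : minkowski (-x) (-x) = minkowski x x := by
  rw [map_neg, map_neg, LinearMap.neg_apply, neg_neg]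

lemma minkowski_self_neg_of_orthogonal {x z : ℝ × E} (hz : 0 < minkowski z z)
    (hxz : minkowski x z = 0) (hx : x ≠ 0) : minkowski x x < 0 := by
  rw [minkowski_self] at hz ⊢
  have cauchy_schwarz : (x.1 * z.1) ^ 2 ≤ (‖x.2‖ * ‖z.2‖) ^ 2 := by
    rw [sub_eq_zero.1 hxz, ← sq_abs (inner ℝ x.2 z.2)]
    gcongr
    exact abs_real_inner_le_norm x.2 z.2
  by_contra! hnonneg
  have hfst : x.1 ^ 2 = 0 := by
    have : x.1 ^ 2 * (z.1 ^ 2 - ‖z.2‖ ^ 2) ≤ 0 := by nlinarith [sq_nonneg ‖z.2‖]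
    exact le_antisymm (nonpos_of_mul_nonpos_left this hz) (sq_nonneg _)
  have hsnd : ‖x.2‖ ^ 2 = 0 := le_antisymm (by linarith) (sq_nonneg _)
  exact hx (Prod.ext (by simpa using hfst) (by simpa using hsnd))

lemma minkowski_self_mul_self_le_sq {x z : ℝ × E} (hz : 0 < minkowski z z) :
    minkowski x x * minkowski z z ≤ minkowski x z ^ 2 := by
  set y := minkowski z z • x - minkowski x z • z with hy
  have hyz : minkowski y z = 0 := by
    simp only [hy, map_sub, map_smul, LinearMap.sub_apply, LinearMap.smul_apply, smul_eq_mul]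
    ring
  have hyy : minkowski y y
      = minkowski z z * (minkowski x x * minkowski z z - minkowski x z ^ 2) := by
    simp only [hy, map_sub, map_smul, LinearMap.sub_apply, LinearMap.smul_apply, smul_eq_mul,
      minkowski_comm z x]
    ring
  have hyy_nonpos : minkowski y y ≤ 0 := by
    rcases eq_or_ne y 0 with h | h
    · rw [h, map_zero]
    · exact (minkowski_self_neg_of_orthogonal hz hyz h).le
  rw [hyy] at hyy_nonpos
  exact sub_nonpos.1 (nonpos_of_mul_nonpos_right hyy_nonpos hz)

lemma norm_snd_lt_abs_fst {x : ℝ × E} (hx : 0 < minkowski x x) : ‖x.2‖ < |x.1| := by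
  rw [minkowski_self, sub_pos] at hx
  simpa using sq_lt_sq.1 hx

lemma fst_pos_of_minkowski_pos {x y : ℝ × E} (hx : 0 < minkowski x x) (hx₁ : 0 < x.1)
    (hy : 0 < minkowski y y) (hxy : 0 < minkowski x y) : 0 < y.1 := by
  by_contra! hy₁
  have hx₂ := norm_snd_lt_abs_fst hx
  have hy₂ := norm_snd_lt_abs_fst hy
  rw [abs_of_pos hx₁] at hx₂
  rw [abs_of_nonpos hy₁] at hy₂
  have := mul_le_mul hx₂.le hy₂.le (norm_nonneg _) hx₁.le
  have := neg_le_of_abs_le (abs_real_inner_le_norm x.2 y.2)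
  rw [minkowski_apply] at hxy
  linarith

end Minkowski

variable {n : ℕ}

/-- The isometry from the ball model to the hyperboloid model: the inverse of the stereographic
projection from `(-1, 0)`. -/
def toHyperboloid (p : Hyp n) : ℝ × EuclideanSpace ℝ (Fin n) :=
  ((1 + ‖p.1‖ ^ 2) / (1 - ‖p.1‖ ^ 2), (2 / (1 - ‖p.1‖ ^ 2)) • p.1)

lemma one_sub_norm_sq_pos (p : Hyp n) : 0 < 1 - ‖p.1‖ ^ 2 := by
  nlinarith [p.2, norm_nonneg p.1]

lemma toHyperboloid_fst_pos (p : Hyp n) : 0 < (toHyperboloid p).1 :=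
  div_pos (by positivity) (one_sub_norm_sq_pos p)

lemma continuous_toHyperboloid : Continuous (toHyperboloid : Hyp n → _) := by
  unfold toHyperboloid
  have := fun p : Hyp n => (one_sub_norm_sq_pos p).ne'
  fun_prop (disch := assumption)

lemma continuous_minkowski_toHyperboloid (ν : ℝ × EuclideanSpace ℝ (Fin n)) :
    Continuous fun x : Hyp n => minkowski ν (toHyperboloid x) := by
  have h := continuous_toHyperboloid (n := n)
  exact (continuous_const.mul h.fst).sub (continuous_const.inner h.snd)

lemma minkowski_toHyperboloid (p q : Hyp n) : minkowski (toHyperboloid p) (toHyperboloid q)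
    = 1 + 2 * ‖p.1 - q.1‖ ^ 2 / ((1 - ‖p.1‖ ^ 2) * (1 - ‖q.1‖ ^ 2)) := by
  have hp := one_sub_norm_sq_pos p
  have hq := one_sub_norm_sq_pos q
  simp only [minkowski_apply, toHyperboloid, real_inner_smul_left, real_inner_smul_right,
    norm_sub_sq_real]
  field_simp
  ring

lemma minkowski_toHyperboloid_self (p : Hyp n) :
    minkowski (toHyperboloid p) (toHyperboloid p) = 1 := by
  simp [minkowski_toHyperboloid]

lemma one_le_minkowski_toHyperboloid (p q : Hyp n) :
    1 ≤ minkowski (toHyperboloid p) (toHyperboloid q) := by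
  have hp := one_sub_norm_sq_pos p
  have hq := one_sub_norm_sq_pos q
  rw [minkowski_toHyperboloid]
  exact le_add_of_nonneg_right (by positivity)

lemma hdist_eq_arcosh (p q : Hyp n) :
    hdist p q = Real.arcosh (minkowski (toHyperboloid p) (toHyperboloid q)) := by
  rw [hdist, minkowski_toHyperboloid]

lemma cosh_hdist (p q : Hyp n) :
    Real.cosh (hdist p q) = minkowski (toHyperboloid p) (toHyperboloid q) := by
  rw [hdist_eq_arcosh, Real.cosh_arcosh (one_le_minkowski_toHyperboloid p q)]

lemma hdist_nonneg (p q : Hyp n) : 0 ≤ hdist p q :=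
  Real.arcosh_nonneg (minkowski_toHyperboloid p q ▸ one_le_minkowski_toHyperboloid p q)

lemma hdist_comm (p q : Hyp n) : hdist p q = hdist q p := by
  rw [hdist_eq_arcosh, hdist_eq_arcosh, minkowski_comm]

lemma hdist_self (p : Hyp n) : hdist p p = 0 := by
  rw [hdist_eq_arcosh, minkowski_toHyperboloid_self, Real.arcosh_zero]

lemma continuous_hdist (p : Hyp n) : Continuous (hdist p) := by
  simp only [funext (hdist_eq_arcosh p)]
  exact Real.continuousOn_arcosh.comp_continuous (continuous_minkowski_toHyperboloid _)
    (one_le_minkowski_toHyperboloid p)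

lemma mem_hball_iff {p q : Hyp n} {r : ℝ} (hr : 0 ≤ r) :
    q ∈ hball p r ↔ minkowski (toHyperboloid p) (toHyperboloid q) ≤ Real.cosh r := by
  rw [← cosh_hdist, Real.cosh_le_cosh, abs_of_nonneg (hdist_nonneg p q), abs_of_nonneg hr]
  rfl

lemma exists_toHyperboloid_eq {x : ℝ × EuclideanSpace ℝ (Fin n)} (hx : minkowski x x = 1)
    (hx₁ : 0 < x.1) : ∃ p : Hyp n, toHyperboloid p = x := by
  have hsnd : ‖x.2‖ ^ 2 = (x.1 - 1) * (x.1 + 1) := by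
    linear_combination minkowski_self x - hx
  have hnorm : ‖(1 + x.1)⁻¹ • x.2‖ ^ 2 = (x.1 - 1) / (x.1 + 1) := by
    rw [norm_smul, mul_pow, Real.norm_eq_abs, sq_abs, hsnd]
    field_simp
    ring
  have hlt : ‖(1 + x.1)⁻¹ • x.2‖ < 1 := by
    rw [← sq_lt_one_iff₀ (norm_nonneg _), hnorm, div_lt_one (by positivity)]
    linarith
  have hden : 1 - (x.1 - 1) / (x.1 + 1) = 2 / (x.1 + 1) := by
    field_simp
    ring
  refine ⟨⟨(1 + x.1)⁻¹ • x.2, hlt⟩, ?_⟩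
  ext1
  · simp only [toHyperboloid, hnorm, hden]
    field_simp
    ring
  · simp only [toHyperboloid, hnorm, hden, smul_smul]
    rw [div_div_cancel₀ two_ne_zero, add_comm, mul_inv_cancel₀ (by positivity), one_smul]

lemma exists_toHyperboloid_eq_cosh_add_sinh (p : Hyp n) {v : ℝ × EuclideanSpace ℝ (Fin n)}
    (hpv : minkowski (toHyperboloid p) v = 0) (hv : minkowski v v = -1) (t : ℝ) :
    ∃ q : Hyp n, toHyperboloid q = Real.cosh t • toHyperboloid p + Real.sinh t • v ∧
      hdist p q = |t| := by
  have hpp := minkowski_toHyperboloid_self p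
  set x := Real.cosh t • toHyperboloid p + Real.sinh t • v with hx
  have hpx : minkowski (toHyperboloid p) x = Real.cosh t := by
    simp only [hx, map_add, map_smul, smul_eq_mul, hpp, hpv]
    ring
  have hxx : minkowski x x = 1 := by
    simp only [hx, map_add, map_smul, LinearMap.add_apply, LinearMap.smul_apply, smul_eq_mul,
      hpp, hpv, minkowski_comm v, hv]
    linear_combination Real.cosh_sq t
  have hx₁ : 0 < x.1 := fst_pos_of_minkowski_pos (hpp ▸ one_pos) (toHyperboloid_fst_pos p)
    (hxx ▸ one_pos) (hpx ▸ Real.cosh_pos t)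
  obtain ⟨q, hq⟩ := exists_toHyperboloid_eq hxx hx₁
  refine ⟨q, hq, ?_⟩
  rw [hdist_eq_arcosh, hq, hpx, ← Real.cosh_abs, Real.arcosh_cosh (abs_nonneg t)]

section HalfSpaces

/-- The half-space of the points `x` with `⟨ν, x⟩ ≥ 0` in the hyperboloid model; a hyperbolic
half-space when `ν` is spacelike, that is, `minkowski ν ν < 0`. -/
def halfSpace (ν : ℝ × EuclideanSpace ℝ (Fin n)) : Set (Hyp n) :=
  {x | 0 ≤ minkowski ν (toHyperboloid x)}

/-- The hyperplane with Minkowski normal vector `ν`. -/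
def hyperplane (ν : ℝ × EuclideanSpace ℝ (Fin n)) : Set (Hyp n) :=
  {x | minkowski ν (toHyperboloid x) = 0}

lemma hyperplane_eq_inter (ν : ℝ × EuclideanSpace ℝ (Fin n)) :
    hyperplane ν = halfSpace ν ∩ halfSpace (-ν) := by
  ext x
  simp [hyperplane, halfSpace, le_antisymm_iff, and_comm]

lemma hyperplane_neg (ν : ℝ × EuclideanSpace ℝ (Fin n)) : hyperplane (-ν) = hyperplane ν := by
  rw [hyperplane_eq_inter, hyperplane_eq_inter, neg_neg, Set.inter_comm]

lemma halfSpace_smul {k : ℝ} (hk : 0 < k) (ν : ℝ × EuclideanSpace ℝ (Fin n)) :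
    halfSpace (k • ν) = halfSpace ν := by
  ext x
  simp [halfSpace, hk]

lemma hyperplane_smul {k : ℝ} (hk : 0 < k) (ν : ℝ × EuclideanSpace ℝ (Fin n)) :
    hyperplane (k • ν) = hyperplane ν := by
  rw [hyperplane_eq_inter, hyperplane_eq_inter, ← smul_neg, halfSpace_smul hk, halfSpace_smul hk]

lemma halfSpace_zero_prod (u : EuclideanSpace ℝ (Fin n)) :
    halfSpace ((0, u) : ℝ × EuclideanSpace ℝ (Fin n)) = {x | inner ℝ u x.1 ≤ 0} := by
  ext x
  have hpos : 0 < 2 / (1 - ‖x.1‖ ^ 2) := div_pos two_pos (one_sub_norm_sq_pos x)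
  have : minkowski (0, u) (toHyperboloid x) = 2 / (1 - ‖x.1‖ ^ 2) * -inner ℝ u x.1 := by
    simp [minkowski_apply, toHyperboloid, real_inner_smul_right]
  rw [halfSpace, Set.mem_ofPred_eq, this, mul_nonneg_iff_of_pos_left hpos, neg_nonneg]
  rfl

lemma linHyperplane_eq_hyperplane (u : EuclideanSpace ℝ (Fin n)) :
    linHyperplane u = hyperplane ((0, u) : ℝ × EuclideanSpace ℝ (Fin n)) := by
  rw [hyperplane_eq_inter, Prod.neg_mk, neg_zero, halfSpace_zero_prod, halfSpace_zero_prod]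
  ext x
  simp [linHyperplane, le_antisymm_iff]

lemma norm_sub_sq_eq_add_minkowski {c : EuclideanSpace ℝ (Fin n)} {r : ℝ}
    (hc : ‖c‖ ^ 2 = 1 + r ^ 2) (x : Hyp n) :
    ‖x.1 - c‖ ^ 2 = r ^ 2 + (1 - ‖x.1‖ ^ 2) * minkowski (1, c) (toHyperboloid x) := by
  have := one_sub_norm_sq_pos x
  rw [norm_sub_sq_real, hc, minkowski_apply, toHyperboloid, real_inner_smul_right,
    real_inner_comm]
  field_simp
  ring

lemma halfSpace_one_prod {c : EuclideanSpace ℝ (Fin n)} {r : ℝ} (hr : 0 < r)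
    (hc : ‖c‖ ^ 2 = 1 + r ^ 2) :
    halfSpace ((1, c) : ℝ × EuclideanSpace ℝ (Fin n)) = {x | r ≤ ‖x.1 - c‖} := by
  ext x
  rw [Set.mem_ofPred_eq, ← sq_le_sq₀ hr.le (norm_nonneg _), norm_sub_sq_eq_add_minkowski hc,
    le_add_iff_nonneg_right, mul_nonneg_iff_of_pos_left (one_sub_norm_sq_pos x)]
  rfl

lemma halfSpace_neg_one_prod {c : EuclideanSpace ℝ (Fin n)} {r : ℝ} (hr : 0 < r)
    (hc : ‖c‖ ^ 2 = 1 + r ^ 2) :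
    halfSpace (-(1, c) : ℝ × EuclideanSpace ℝ (Fin n)) = {x | ‖x.1 - c‖ ≤ r} := by
  ext x
  rw [Set.mem_ofPred_eq, ← sq_le_sq₀ (norm_nonneg _) hr.le, norm_sub_sq_eq_add_minkowski hc,
    add_le_iff_nonpos_right, ← neg_nonneg, ← mul_neg,
    mul_nonneg_iff_of_pos_left (one_sub_norm_sq_pos x), ← LinearMap.neg_apply, ← map_neg]
  rfl

lemma sphHyperplane_eq_hyperplane {c : EuclideanSpace ℝ (Fin n)} {r : ℝ} (hr : 0 < r)
    (hc : ‖c‖ ^ 2 = 1 + r ^ 2) :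
    sphHyperplane c r = hyperplane ((1, c) : ℝ × EuclideanSpace ℝ (Fin n)) := by
  rw [hyperplane_eq_inter, halfSpace_one_prod hr hc, halfSpace_neg_one_prod hr hc]
  ext x
  simp [sphHyperplane, le_antisymm_iff, and_comm]

lemma IsHalfSpaceOf.exists_normal {H P : Set (Hyp n)} (h : IsHalfSpaceOf H P) :
    ∃ ν : ℝ × EuclideanSpace ℝ (Fin n),
      minkowski ν ν < 0 ∧ H = hyperplane ν ∧ P = halfSpace ν := by
  rcases h with ⟨u, hu, rfl, hP⟩ | ⟨c, r, hr, hc, rfl, hP⟩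
  · have hν : minkowski ((0, u) : ℝ × EuclideanSpace ℝ (Fin n)) (0, u) < 0 := by
      simpa [minkowski_self, sq_pos_iff] using hu
    have hH := linHyperplane_eq_hyperplane u
    rcases hP with rfl | rfl
    · exact ⟨(0, u), hν, hH, (halfSpace_zero_prod u).symm⟩
    · refine ⟨-(0, u), (minkowski_neg_neg _).trans_lt hν, hH.trans (hyperplane_neg _).symm, ?_⟩
      rw [Prod.neg_mk, neg_zero, halfSpace_zero_prod]
      simp
  · have hν : minkowski ((1, c) : ℝ × EuclideanSpace ℝ (Fin n)) (1, c) < 0 := by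
      rw [minkowski_self, hc]
      linarith [pow_pos hr 2]
    have hH := sphHyperplane_eq_hyperplane hr hc
    rcases hP with rfl | rfl
    · exact ⟨-(1, c), (minkowski_neg_neg _).trans_lt hν, hH.trans (hyperplane_neg _).symm,
        (halfSpace_neg_one_prod hr hc).symm⟩
    · exact ⟨(1, c), hν, hH, (halfSpace_one_prod hr hc).symm⟩

lemma isHalfSpaceOf_hyperplane {ν : ℝ × EuclideanSpace ℝ (Fin n)} (hν : minkowski ν ν < 0) :
    IsHalfSpaceOf (hyperplane ν) (halfSpace ν) := by
  obtain ⟨a, u⟩ := ν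
  rw [minkowski_self, sub_neg] at hν
  rcases eq_or_ne a 0 with rfl | ha
  · have hu : u ≠ 0 := by simpa [sq_pos_iff] using hν
    exact Or.inl ⟨u, hu, (linHyperplane_eq_hyperplane u).symm, Or.inl (halfSpace_zero_prod u)⟩
  set c := a⁻¹ • u with hc_def
  set r := √(‖c‖ ^ 2 - 1) with hr_def
  have hac : a • ((1, c) : ℝ × EuclideanSpace ℝ (Fin n)) = (a, u) := by
    simp [hc_def, ha]
  have hc_gt : 0 < ‖c‖ ^ 2 - 1 := by
    rw [hc_def, norm_smul, mul_pow, norm_inv, inv_pow, Real.norm_eq_abs, sq_abs, sub_pos,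
      ← div_eq_inv_mul, one_lt_div (by positivity)]
    exact hν
  have hr : 0 < r := Real.sqrt_pos.2 hc_gt
  have hc : ‖c‖ ^ 2 = 1 + r ^ 2 := by rw [hr_def, Real.sq_sqrt hc_gt.le, add_sub_cancel]
  refine Or.inr ⟨c, r, hr, hc, ?_⟩
  rw [sphHyperplane_eq_hyperplane hr hc, ← halfSpace_neg_one_prod hr hc,
    ← halfSpace_one_prod hr hc, ← hac]
  rcases ha.lt_or_gt with ha | ha
  · rw [← neg_smul_neg, hyperplane_smul (neg_pos.2 ha), halfSpace_smul (neg_pos.2 ha)]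
    exact ⟨hyperplane_neg _, Or.inl rfl⟩
  · rw [hyperplane_smul ha, halfSpace_smul ha]
    exact ⟨rfl, Or.inr rfl⟩

lemma IsHalfSpaceOf.isHyperplane {H P : Set (Hyp n)} (h : IsHalfSpaceOf H P) : IsHyperplane H :=
  h.imp (fun ⟨u, hu, hH, _⟩ => ⟨u, hu, hH⟩) (fun ⟨c, r, hr, hc, hH, _⟩ => ⟨c, r, hr, hc, hH⟩)

end HalfSpaces

section Distances

variable {ν : ℝ × EuclideanSpace ℝ (Fin n)}

lemma sq_minkowski_le_mul_sinh_sq (hν : minkowski ν ν < 0) {x y : Hyp n} (hy : y ∈ hyperplane ν) :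
    minkowski ν (toHyperboloid x) ^ 2 ≤ -minkowski ν ν * Real.sinh (hdist x y) ^ 2 := by
  set b := minkowski ν (toHyperboloid x)
  have hy' : minkowski ν (toHyperboloid y) = 0 := hy
  have hxx := minkowski_toHyperboloid_self x
  have hyy := minkowski_toHyperboloid_self y
  -- Reversed Cauchy–Schwarz for `y` and a multiple of the projection of `x` to `ν^⊥`.
  set u := minkowski ν ν • toHyperboloid x - b • ν with hu
  have huu : minkowski u u = minkowski ν ν ^ 2 - minkowski ν ν * b ^ 2 := by
    simp only [hu, map_sub, map_smul, LinearMap.sub_apply, LinearMap.smul_apply, smul_eq_mul, hxx,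
      minkowski_comm (toHyperboloid x) ν]
    ring
  have huy : minkowski u (toHyperboloid y) = minkowski ν ν * Real.cosh (hdist x y) := by
    simp only [hu, map_sub, map_smul, LinearMap.sub_apply, LinearMap.smul_apply, smul_eq_mul, hy',
      cosh_hdist]
    ring
  have key := minkowski_self_mul_self_le_sq (x := u) (hyy ▸ one_pos)
  rw [huu, huy, hyy, mul_pow, Real.cosh_sq] at key
  refine le_of_mul_le_mul_left ?_ (neg_pos.2 hν)
  linarith

lemma exists_hdist_eq_abs_minkowski_eq (hν : minkowski ν ν < 0) (p : Hyp n) (t : ℝ) :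
    ∃ q : Hyp n, hdist p q = |t| ∧
      minkowski ν (toHyperboloid q) = Real.cosh t * minkowski ν (toHyperboloid p)
        - Real.sinh t * √(minkowski ν (toHyperboloid p) ^ 2 - minkowski ν ν) := by
  set a := minkowski ν (toHyperboloid p)
  have hpp := minkowski_toHyperboloid_self p
  have hpν : minkowski (toHyperboloid p) ν = a := minkowski_comm _ _
  have hpos : 0 < a ^ 2 - minkowski ν ν := by linarith [sq_nonneg a]
  set k := √(a ^ 2 - minkowski ν ν)
  have hk : 0 < k := Real.sqrt_pos.2 hpos
  have hk_sq : k ^ 2 = a ^ 2 - minkowski ν ν := Real.sq_sqrt hpos.le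
  -- The unit tangent vector at `p` along which the distance to `ν^⊥` changes fastest.
  set v := k⁻¹ • (ν - a • toHyperboloid p) with hv_def
  have hpv : minkowski (toHyperboloid p) v = 0 := by
    simp [hv_def, hpp, hpν]
  have hv : minkowski v v = -1 := by
    simp only [hv_def, map_sub, map_smul, LinearMap.sub_apply, LinearMap.smul_apply, smul_eq_mul,
      hpp, hpν]
    field_simp
    linear_combination hk_sq
  have hνv : minkowski ν v = -k := by
    simp only [hv_def, map_sub, map_smul, smul_eq_mul]
    field_simp
    linear_combination hk_sq
  obtain ⟨q, hq, hpq⟩ := exists_toHyperboloid_eq_cosh_add_sinh p hpv hv t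
  refine ⟨q, hpq, ?_⟩
  rw [hq, map_add, map_smul, map_smul, hνv, smul_eq_mul, smul_eq_mul]
  ring

lemma sinh_mul_sqrt_le_of_hball_subset_halfSpace (hν : minkowski ν ν < 0) {p : Hyp n} {δ : ℝ}
    (hδ : 0 ≤ δ) (hball : hball p δ ⊆ halfSpace ν) :
    Real.sinh δ * √(minkowski ν (toHyperboloid p) ^ 2 - minkowski ν ν)
      ≤ Real.cosh δ * minkowski ν (toHyperboloid p) := by
  obtain ⟨q, hpq, hq⟩ := exists_hdist_eq_abs_minkowski_eq hν p δ
  have : 0 ≤ minkowski ν (toHyperboloid q) := hball (hpq.trans_le (abs_of_nonneg hδ).le)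
  linarith

lemma sinh_mul_le_cosh_mul_sinh_hdist (hν : minkowski ν ν < 0) {p x y : Hyp n} {δ κ : ℝ}
    (hδ : 0 ≤ δ) (hball : hball p δ ⊆ halfSpace ν) (hκ : 0 ≤ κ)
    (hx : κ * minkowski ν (toHyperboloid p) ≤ minkowski ν (toHyperboloid x))
    (hy : y ∈ hyperplane ν) : Real.sinh δ * κ ≤ Real.cosh δ * Real.sinh (hdist x y) := by
  set a := minkowski ν (toHyperboloid p)
  have hpos : 0 < a ^ 2 - minkowski ν ν := by linarith [sq_nonneg a]
  set k := √(a ^ 2 - minkowski ν ν)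
  have hk_sq : k ^ 2 = a ^ 2 - minkowski ν ν := Real.sq_sqrt hpos.le
  have hx_le : minkowski ν (toHyperboloid x) ≤ k * Real.sinh (hdist x y) := by
    refine le_of_sq_le_sq ?_
      (mul_nonneg (Real.sqrt_nonneg _) (Real.sinh_nonneg_iff.2 (hdist_nonneg x y)))
    refine (sq_minkowski_le_mul_sinh_sq hν hy).trans ?_
    rw [mul_pow, hk_sq]
    gcongr
    linarith [sq_nonneg a]
  refine le_of_mul_le_mul_left ?_ (Real.sqrt_pos.2 hpos)
  calc k * (Real.sinh δ * κ) = κ * (Real.sinh δ * k) := by ring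
    _ ≤ κ * (Real.cosh δ * a) :=
      mul_le_mul_of_nonneg_left (sinh_mul_sqrt_le_of_hball_subset_halfSpace hν hδ hball) hκ
    _ = Real.cosh δ * (κ * a) := by ring
    _ ≤ Real.cosh δ * (k * Real.sinh (hdist x y)) :=
      mul_le_mul_of_nonneg_left (hx.trans hx_le) (Real.cosh_pos δ).le
    _ = k * (Real.cosh δ * Real.sinh (hdist x y)) := by ring

end Distances

section Convexity

lemma toHyperboloid_eq_of_hdist_eq_zero {p q : Hyp n} (h : hdist p q = 0) :
    toHyperboloid p = toHyperboloid q := by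
  have hpq : minkowski (toHyperboloid p) (toHyperboloid q) = 1 := by
    rw [← cosh_hdist, h, Real.cosh_zero]
  have hpp := minkowski_toHyperboloid_self p
  have hqq := minkowski_toHyperboloid_self q
  by_contra hne
  refine (minkowski_self_neg_of_orthogonal (x := toHyperboloid p - toHyperboloid q)
    (hqq ▸ one_pos) ?_ (sub_ne_zero.2 hne)).ne ?_
  · rw [map_sub, LinearMap.sub_apply, hpq, hqq, sub_self]
  · simp only [map_sub, LinearMap.sub_apply, minkowski_comm (toHyperboloid q), hpp, hqq, hpq]
    ring

lemma sinh_smul_toHyperboloid_of_mem_hsegment {x y z : Hyp n} (hz : z ∈ hsegment x y) :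
    Real.sinh (hdist x y) • toHyperboloid z
      = Real.sinh (hdist z y) • toHyperboloid x + Real.sinh (hdist x z) • toHyperboloid y := by
  have hadd : hdist x z + hdist z y = hdist x y := hz
  have hxx := minkowski_toHyperboloid_self x
  have hyy := minkowski_toHyperboloid_self y
  have hzz := minkowski_toHyperboloid_self z
  set s := hdist x z
  set t := hdist z y
  have hxz : minkowski (toHyperboloid x) (toHyperboloid z) = Real.cosh s := (cosh_hdist x z).symm
  have hzy : minkowski (toHyperboloid z) (toHyperboloid y) = Real.cosh t := (cosh_hdist z y).symm
  have hxy : minkowski (toHyperboloid x) (toHyperboloid y) = Real.cosh (s + t) := by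
    rw [hadd, cosh_hdist]
  rw [← hadd]
  set u := Real.sinh (s + t) • toHyperboloid z
    - (Real.sinh t • toHyperboloid x + Real.sinh s • toHyperboloid y) with hu
  -- `u` is isotropic and orthogonal to the timelike vector `z`.
  have huz : minkowski u (toHyperboloid z) = 0 := by
    simp only [hu, map_sub, map_add, map_smul, LinearMap.sub_apply, LinearMap.add_apply,
      LinearMap.smul_apply, smul_eq_mul, hzz, hxz, minkowski_comm (toHyperboloid y), hzy,
      Real.sinh_add]
    ring
  have huu : minkowski u u = 0 := by
    simp only [hu, map_sub, map_add, map_smul, LinearMap.sub_apply, LinearMap.add_apply,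
      LinearMap.smul_apply, smul_eq_mul, hxx, hyy, hzz, hxz, minkowski_comm (toHyperboloid y),
      minkowski_comm (toHyperboloid z) (toHyperboloid x), hzy, hxy, Real.sinh_add, Real.cosh_add]
    linear_combination -Real.sinh s ^ 2 * Real.cosh_sq t - Real.sinh t ^ 2 * Real.cosh_sq s
  by_contra hne
  exact (minkowski_self_neg_of_orthogonal (hzz ▸ one_pos) huz (sub_ne_zero.2 hne)).ne huu

lemma sinh_add_sinh_le {a b : ℝ} (ha : 0 ≤ a) (hb : 0 ≤ b) :
    Real.sinh a + Real.sinh b ≤ Real.sinh (a + b) := by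
  rw [Real.sinh_add]
  exact add_le_add
    (le_mul_of_one_le_right (Real.sinh_nonneg_iff.2 ha) (Real.one_le_cosh b))
    (le_mul_of_one_le_left (Real.sinh_nonneg_iff.2 hb) (Real.one_le_cosh a))

lemma hconvex_setOf_le (φ : ℝ × EuclideanSpace ℝ (Fin n) →ₗ[ℝ] ℝ) {c : ℝ} (hc : 0 ≤ c) :
    HConvex {x : Hyp n | φ (toHyperboloid x) ≤ c} := by
  intro x hx y hy z hz
  have hadd : hdist x z + hdist z y = hdist x y := hz
  rcases (hdist_nonneg x y).eq_or_lt with h0 | hpos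
  · have hxz : hdist x z = 0 := by linarith [hdist_nonneg x z, hdist_nonneg z y]
    rwa [Set.mem_ofPred_eq, ← toHyperboloid_eq_of_hdist_eq_zero hxz]
  · have hcomb := congrArg φ (sinh_smul_toHyperboloid_of_mem_hsegment hz)
    simp only [map_add, map_smul, smul_eq_mul] at hcomb
    refine le_of_mul_le_mul_left ?_ (Real.sinh_pos_iff.2 hpos)
    have hxz := Real.sinh_nonneg_iff.2 (hdist_nonneg x z)
    have hzy := Real.sinh_nonneg_iff.2 (hdist_nonneg z y)
    calc Real.sinh (hdist x y) * φ (toHyperboloid z)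
        = Real.sinh (hdist z y) * φ (toHyperboloid x)
          + Real.sinh (hdist x z) * φ (toHyperboloid y) := hcomb
      _ ≤ Real.sinh (hdist z y) * c + Real.sinh (hdist x z) * c := by
        gcongr
        exacts [hx, hy]
      _ = (Real.sinh (hdist x z) + Real.sinh (hdist z y)) * c := by ring
      _ ≤ Real.sinh (hdist x y) * c := by
        gcongr
        exact hadd ▸ sinh_add_sinh_le (hdist_nonneg x z) (hdist_nonneg z y)

lemma HConvex.inter {K K' : Set (Hyp n)} (hK : HConvex K) (hK' : HConvex K') :
    HConvex (K ∩ K') := fun x hx y hy =>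
  Set.subset_inter (hK x hx.1 y hy.1) (hK' x hx.2 y hy.2)

lemma hconvex_hball (p : Hyp n) {r : ℝ} (hr : 0 ≤ r) : HConvex (hball p r) := by
  have : hball p r = {x | minkowski (toHyperboloid p) (toHyperboloid x) ≤ Real.cosh r} :=
    Set.ext fun _ => mem_hball_iff hr
  rw [this]
  exact hconvex_setOf_le (minkowski (toHyperboloid p)) (Real.cosh_pos r).le

end Convexity

section Slabs

/-- The closed `δ`-neighbourhood of the hyperplane with normal vector `ν`, if `ν` is normalized
by `minkowski ν ν = -1`: then `|minkowski ν x|` is the `sinh` of the distance from `x` to it. -/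
def slab (ν : ℝ × EuclideanSpace ℝ (Fin n)) (δ : ℝ) : Set (Hyp n) :=
  {x | |minkowski ν (toHyperboloid x)| ≤ Real.sinh δ}

variable {ν : ℝ × EuclideanSpace ℝ (Fin n)}

lemma isClosed_slab (ν : ℝ × EuclideanSpace ℝ (Fin n)) (δ : ℝ) : IsClosed (slab ν δ) :=
  isClosed_le (continuous_minkowski_toHyperboloid ν).abs continuous_const

lemma hconvex_slab (ν : ℝ × EuclideanSpace ℝ (Fin n)) {δ : ℝ} (hδ : 0 ≤ δ) :
    HConvex (slab ν δ) := by
  have : slab ν δ = {x | minkowski ν (toHyperboloid x) ≤ Real.sinh δ}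
      ∩ {x | (-minkowski ν) (toHyperboloid x) ≤ Real.sinh δ} := Set.ext fun _ => by
    simp [slab, abs_le']
  rw [this]
  have hδ' := Real.sinh_nonneg_iff.2 hδ
  exact (hconvex_setOf_le (minkowski ν) hδ').inter (hconvex_setOf_le (-minkowski ν) hδ')

lemma hball_subset_slab (hν : minkowski ν ν = -1) {p : Hyp n} (hp : p ∈ hyperplane ν) (δ : ℝ) :
    hball p δ ⊆ slab ν δ := by
  intro x hx
  have hle := sq_minkowski_le_mul_sinh_sq (hν ▸ neg_one_lt_zero) (x := x) hp
  rw [hν, neg_neg, one_mul, hdist_comm] at hle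
  exact (abs_le_of_sq_le_sq hle (Real.sinh_nonneg_iff.2 (hdist_nonneg p x))).trans
    (Real.sinh_le_sinh.2 hx)

lemma le_of_hball_subset_slab (hν : minkowski ν ν = -1) {p : Hyp n} {r δ : ℝ} (hr : 0 ≤ r)
    (h : hball p r ⊆ slab ν δ) : r ≤ δ := by
  have hν_neg : minkowski ν ν < 0 := hν ▸ neg_one_lt_zero
  -- Compare the endpoints of the diameter through `p` perpendicular to the hyperplane.
  obtain ⟨q₁, hpq₁, hq₁⟩ := exists_hdist_eq_abs_minkowski_eq hν_neg p r
  obtain ⟨q₂, hpq₂, hq₂⟩ := exists_hdist_eq_abs_minkowski_eq hν_neg p (-r)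
  have h₁ : |minkowski ν (toHyperboloid q₁)| ≤ Real.sinh δ :=
    h (hpq₁.trans_le (abs_of_nonneg hr).le)
  have h₂ : |minkowski ν (toHyperboloid q₂)| ≤ Real.sinh δ :=
    h (hpq₂.trans_le (abs_neg r ▸ (abs_of_nonneg hr).le))
  replace h₁ := neg_le_of_abs_le h₁
  replace h₂ := le_of_abs_le h₂
  rw [hq₁, hν] at h₁
  rw [hq₂, hν, Real.cosh_neg, Real.sinh_neg] at h₂
  have hsqrt : 1 ≤ √(minkowski ν (toHyperboloid p) ^ 2 - -1) :=
    Real.one_le_sqrt.2 (by linarith [sq_nonneg (minkowski ν (toHyperboloid p))])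
  have := le_mul_of_one_le_right (Real.sinh_nonneg_iff.2 hr) hsqrt
  exact Real.sinh_le_sinh.1 (by linarith)

end Slabs

section Compactness

lemma isCompact_setOf_toHyperboloid_fst_le {T : ℝ} (hT : 0 ≤ T) :
    IsCompact {x : Hyp n | (toHyperboloid x).1 ≤ T} := by
  set ρ := √(1 - 2 / (T + 1)) with hρ
  have hρ_lt : ρ < 1 := by
    rw [hρ, Real.sqrt_lt' one_pos, one_pow, sub_lt_self_iff]
    positivity
  have hball : IsCompact ((Subtype.val : Hyp n → _) ⁻¹' Metric.closedBall 0 ρ) := by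
    refine (Topology.IsInducing.subtypeVal.isCompact_preimage_iff fun x hx => ?_).2
      (isCompact_closedBall _ _)
    exact ⟨⟨x, (mem_closedBall_zero_iff.1 hx).trans_lt hρ_lt⟩, rfl⟩
  refine hball.of_isClosed_subset
    (isClosed_le continuous_toHyperboloid.fst continuous_const) fun x hx => ?_
  rw [Set.mem_preimage, mem_closedBall_zero_iff]
  refine Real.le_sqrt_of_sq_le ?_
  rw [Set.mem_ofPred_eq, toHyperboloid, div_le_iff₀ (one_sub_norm_sq_pos x)] at hx
  rw [le_sub_comm, div_le_iff₀ (by positivity)]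
  linarith

lemma isCompact_hball (p : Hyp n) (r : ℝ) : IsCompact (hball p r) := by
  have hgap : 0 < (toHyperboloid p).1 - ‖(toHyperboloid p).2‖ := by
    have := norm_snd_lt_abs_fst (x := toHyperboloid p) (minkowski_toHyperboloid_self p ▸ one_pos)
    rwa [abs_of_pos (toHyperboloid_fst_pos p), ← sub_pos] at this
  refine (isCompact_setOf_toHyperboloid_fst_le
    (div_nonneg (Real.cosh_pos r).le hgap.le)).of_isClosed_subset
    (isClosed_le (continuous_hdist p) continuous_const) fun x hx => ?_
  have hx' : hdist p x ≤ r := hx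
  have hle := (mem_hball_iff ((hdist_nonneg p x).trans hx')).1 hx
  have hsnd := norm_snd_lt_abs_fst (x := toHyperboloid x)
    (minkowski_toHyperboloid_self x ▸ one_pos)
  rw [abs_of_pos (toHyperboloid_fst_pos x)] at hsnd
  have hinner := real_inner_le_norm (toHyperboloid p).2 (toHyperboloid x).2
  have := mul_le_mul_of_nonneg_left hsnd.le (norm_nonneg (toHyperboloid p).2)
  rw [minkowski_apply] at hle
  rw [Set.mem_ofPred_eq, le_div_iff₀ hgap]
  linarith

end Compactness

section Widths

lemma inradius_nonneg (K : Set (Hyp n)) : 0 ≤ inradius K :=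
  Real.sSup_nonneg fun _ hr => hr.1.le

lemma inradius_le_of_subset_slab {K : Set (Hyp n)} {ν : ℝ × EuclideanSpace ℝ (Fin n)}
    (hν : minkowski ν ν = -1) {δ : ℝ} (hδ : 0 ≤ δ) (hK : K ⊆ slab ν δ) : inradius K ≤ δ :=
  Real.sSup_le (fun _ ⟨hr, _, hball⟩ => le_of_hball_subset_slab hν hr.le (hball.trans hK)) hδ

lemma hdistSet_le_hdist {H : Set (Hyp n)} (x : Hyp n) {y : Hyp n} (hy : y ∈ H) :
    hdistSet x H ≤ hdist x y :=
  csInf_le ⟨0, by rintro _ ⟨z, -, rfl⟩; exact hdist_nonneg x z⟩ ⟨y, hy, rfl⟩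

lemma le_lassakWidth {K H : Set (Hyp n)} (hK : IsCompact K) (hH : H.Nonempty) {x : Hyp n}
    (hx : x ∈ K) {w : ℝ} (hw : ∀ y ∈ H, w ≤ hdist x y) : w ≤ lassakWidth K H := by
  obtain ⟨y, hy⟩ := hH
  obtain ⟨M, hM⟩ := hK.bddAbove_image (continuous_hdist y).continuousOn
  have hbdd : BddAbove {t | ∃ x ∈ K, t = hdistSet x H} := by
    refine ⟨M, ?_⟩
    rintro _ ⟨z, hz, rfl⟩
    exact (hdistSet_le_hdist z hy).trans (hdist_comm z y ▸ hM (Set.mem_image_of_mem _ hz))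
  have hle : w ≤ hdistSet x H :=
    le_csInf ⟨_, y, hy, rfl⟩ (by rintro _ ⟨z, hz, rfl⟩; exact hw z hz)
  exact hle.trans (le_csSup hbdd ⟨x, hx, rfl⟩)

/-- The hypothesis `hq` says that `p` is the midpoint of `q₁` and `q₂`, at distance `arcosh κ`
from both. -/
lemma le_lassakWidth_of_midpoint {K H : Set (Hyp n)} (hK : IsCompact K) (hH : IsSupporting H K)
    {p q₁ q₂ : Hyp n} {δ κ w : ℝ} (hδ : 0 ≤ δ) (hball : hball p δ ⊆ K) (hq₁ : q₁ ∈ K)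
    (hq₂ : q₂ ∈ K) (hκ : 0 ≤ κ)
    (hq : toHyperboloid q₁ + toHyperboloid q₂ = (2 * κ) • toHyperboloid p)
    (hw : Real.cosh δ * Real.sinh w ≤ Real.sinh δ * κ) : w ≤ lassakWidth K H := by
  obtain ⟨-, ⟨y, hyH, -⟩, P, hP, hKP⟩ := hH
  obtain ⟨ν, hν, rfl, rfl⟩ := hP.exists_normal
  have hsum := congrArg (minkowski ν) hq
  rw [map_add, map_smul, smul_eq_mul] at hsum
  have hfar : ∃ x ∈ K, κ * minkowski ν (toHyperboloid p) ≤ minkowski ν (toHyperboloid x) := by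
    by_contra! hlt
    linarith [hlt q₁ hq₁, hlt q₂ hq₂]
  obtain ⟨x, hxK, hx⟩ := hfar
  refine le_lassakWidth hK ⟨y, hyH⟩ hxK fun z hz => Real.sinh_le_sinh.1 ?_
  refine le_of_mul_le_mul_left (hw.trans ?_) (Real.cosh_pos δ)
  exact sinh_mul_le_cosh_mul_sinh_hdist hν hδ (hball.trans hKP) hκ hx hz

lemma exists_isSupporting_of_subset_hball {K : Set (Hyp n)} {p q : Hyp n} (hq : q ∈ K)
    (hpq : 0 < hdist p q) (hK : K ⊆ hball p (hdist p q)) : ∃ H, IsSupporting H K := by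
  set c := Real.cosh (hdist p q)
  have hc : 1 < c := Real.one_lt_cosh.2 hpq.ne'
  have hpp := minkowski_toHyperboloid_self p
  have hqq := minkowski_toHyperboloid_self q
  have hpq' : minkowski (toHyperboloid p) (toHyperboloid q) = c := (cosh_hdist p q).symm
  -- A normal vector at `q` of the sphere with centre `p` through `q`.
  set ν := c • toHyperboloid q - toHyperboloid p with hν_def
  have hν : minkowski ν ν < 0 := by
    have : minkowski ν ν = 1 - c ^ 2 := by
      simp only [hν_def, map_sub, map_smul, LinearMap.sub_apply, LinearMap.smul_apply,
        smul_eq_mul, hpp, hqq, minkowski_comm (toHyperboloid q), hpq']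
      ring
    nlinarith
  have hhalf := isHalfSpaceOf_hyperplane hν
  refine ⟨hyperplane ν, hhalf.isHyperplane, ⟨q, ?_, hq⟩, halfSpace ν, hhalf, fun x hx => ?_⟩
  · simp [hyperplane, hν_def, hqq, hpq']
  · have hpx := (mem_hball_iff (hdist_nonneg p q)).1 (hK hx)
    have hqx := le_mul_of_one_le_right (zero_lt_one.trans hc).le
      (one_le_minkowski_toHyperboloid q x)
    simp only [halfSpace, hν_def, Set.mem_ofPred_eq, map_sub, map_smul, LinearMap.sub_apply,
      LinearMap.smul_apply, smul_eq_mul]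
    linarith

end Widths

section TruncatedSlabs

/-- The part of the `δ`-neighbourhood of the hyperplane with normal vector `ν` within distance `L`
of `p`. With `p` on the hyperplane, `δ` fixed and `L` large, these are the convex bodies of
inradius at most `δ` and large minimal Lassak width. -/
def truncatedSlab (p : Hyp n) (ν : ℝ × EuclideanSpace ℝ (Fin n)) (L δ : ℝ) : Set (Hyp n) :=
  hball p L ∩ slab ν δ

variable {p : Hyp n} {ν e : ℝ × EuclideanSpace ℝ (Fin n)} {L δ w : ℝ}

lemma isCompact_truncatedSlab : IsCompact (truncatedSlab p ν L δ) :=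
  (isCompact_hball p L).inter_right (isClosed_slab ν δ)

lemma hball_subset_truncatedSlab (hν : minkowski ν ν = -1) (hp : p ∈ hyperplane ν) (hδL : δ ≤ L) :
    hball p δ ⊆ truncatedSlab p ν L δ :=
  Set.subset_inter (fun _ hx => le_trans hx hδL) (hball_subset_slab hν hp δ)

lemma isConvexBody_truncatedSlab (hν : minkowski ν ν = -1) (hp : p ∈ hyperplane ν) (hδ : 0 < δ)
    (hδL : δ ≤ L) : IsConvexBody (truncatedSlab p ν L δ) where
  isCompact := isCompact_truncatedSlab
  convex := (hconvex_hball p (hδ.le.trans hδL)).inter (hconvex_slab ν hδ.le)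
  interior_nonempty := by
    refine ⟨p, mem_interior.2 ⟨{x | hdist p x < δ}, fun x hx => ?_,
      isOpen_lt (continuous_hdist p) continuous_const, (hdist_self p).trans_lt hδ⟩⟩
    have hx' : hdist p x < δ := hx
    exact hball_subset_truncatedSlab hν hp hδL hx'.le

lemma exists_mem_truncatedSlab_toHyperboloid_eq (hp : p ∈ hyperplane ν)
    (hpe : minkowski (toHyperboloid p) e = 0) (he : minkowski e e = -1) (hνe : minkowski ν e = 0)
    (hδ : 0 ≤ δ) {t : ℝ} (ht : |t| ≤ L) : ∃ q ∈ truncatedSlab p ν L δ,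
      toHyperboloid q = Real.cosh t • toHyperboloid p + Real.sinh t • e ∧ hdist p q = |t| := by
  obtain ⟨q, hq, hpq⟩ := exists_toHyperboloid_eq_cosh_add_sinh p hpe he t
  have hνp : minkowski ν (toHyperboloid p) = 0 := hp
  refine ⟨q, ⟨hpq.trans_le ht, ?_⟩, hq, hpq⟩
  simpa [slab, hq, hνp, hνe] using hδ

lemma le_minLassakWidth_truncatedSlab (hν : minkowski ν ν = -1) (hp : p ∈ hyperplane ν)
    (hpe : minkowski (toHyperboloid p) e = 0) (he : minkowski e e = -1) (hνe : minkowski ν e = 0)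
    (hδ : 0 < δ) (hδL : δ ≤ L) (hw : Real.cosh δ * Real.sinh w ≤ Real.sinh δ * Real.cosh L) :
    w ≤ minLassakWidth (truncatedSlab p ν L δ) := by
  have hL : 0 < L := hδ.trans_le hδL
  obtain ⟨q₁, hq₁K, hq₁, hpq₁⟩ := exists_mem_truncatedSlab_toHyperboloid_eq hp hpe he hνe hδ.le
    (abs_of_pos hL).le
  obtain ⟨q₂, hq₂K, hq₂, -⟩ := exists_mem_truncatedSlab_toHyperboloid_eq hp hpe he hνe hδ.le
    ((abs_neg L).trans (abs_of_pos hL)).le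
  rw [abs_of_pos hL] at hpq₁
  have hmid : toHyperboloid q₁ + toHyperboloid q₂ = (2 * Real.cosh L) • toHyperboloid p := by
    rw [hq₁, hq₂, Real.cosh_neg, Real.sinh_neg]
    module
  obtain ⟨H, hH⟩ := exists_isSupporting_of_subset_hball hq₁K (hpq₁ ▸ hL)
    (hpq₁ ▸ Set.inter_subset_left)
  refine le_csInf ⟨_, H, hH, rfl⟩ ?_
  rintro _ ⟨H', hH', rfl⟩
  exact le_lassakWidth_of_midpoint isCompact_truncatedSlab hH' hδ.le
    (hball_subset_truncatedSlab hν hp hδL) hq₁K hq₂K (Real.cosh_pos L).le hmid hw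

end TruncatedSlabs

/-- The centre of the ball model. -/
def origin (n : ℕ) : Hyp n := ⟨0, by simp⟩

lemma toHyperboloid_origin : toHyperboloid (origin n) = (1, 0) := by
  simp [toHyperboloid, origin]

lemma exists_le_le_cosh (a b : ℝ) : ∃ L, a ≤ L ∧ b ≤ Real.cosh L := by
  refine ⟨max a (max b 0), le_max_left _ _, ?_⟩
  calc b ≤ max a (max b 0) := le_max_of_le_right (le_max_left _ _)
    _ ≤ Real.sinh (max a (max b 0)) :=
      Real.self_le_sinh_iff.2 (le_max_of_le_right (le_max_right _ _))
    _ ≤ Real.cosh (max a (max b 0)) := (Real.sinh_lt_cosh _).le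

lemma exists_isConvexBody_inradius_le (hn : 2 ≤ n) (w : ℝ) {δ : ℝ} (hδ : 0 < δ) :
    ∃ K : Set (Hyp n), IsConvexBody K ∧ w ≤ minLassakWidth K ∧ inradius K ≤ δ := by
  have : Nontrivial (Fin n) := Fin.nontrivial_iff_two_le.2 hn
  obtain ⟨i, j, hij⟩ := exists_pair_ne (Fin n)
  let ν : ℝ × EuclideanSpace ℝ (Fin n) := (0, EuclideanSpace.single i 1)
  let e : ℝ × EuclideanSpace ℝ (Fin n) := (0, EuclideanSpace.single j 1)
  have hν : minkowski ν ν = -1 := by simp [minkowski_self, ν]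
  have he : minkowski e e = -1 := by simp [minkowski_self, e]
  have hνe : minkowski ν e = 0 := by
    simp [minkowski_apply, ν, e, EuclideanSpace.inner_single_left, hij]
  have hp : origin n ∈ hyperplane ν := by
    simp [hyperplane, toHyperboloid_origin, minkowski_apply, ν]
  have hpe : minkowski (toHyperboloid (origin n)) e = 0 := by
    simp [toHyperboloid_origin, minkowski_apply, e]
  obtain ⟨L, hδL, hL⟩ := exists_le_le_cosh δ (Real.cosh δ * Real.sinh w / Real.sinh δ)
  rw [div_le_iff₀' (Real.sinh_pos_iff.2 hδ)] at hL
  exact ⟨truncatedSlab (origin n) ν L δ, isConvexBody_truncatedSlab hν hp hδ hδL,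
    le_minLassakWidth_truncatedSlab hν hp hpe he hνe hδ hδL hL,
    inradius_le_of_subset_slab hν hδ.le Set.inter_subset_right⟩

end PoincareBall

end

theorem corollary3p3 (n : ℕ) (hn : 2 ≤ n) (w : ℝ) (hw : 0 < w) :
    IsGLB {ρ : ℝ | ∃ K : Set (PoincareBall.Hyp n), PoincareBall.IsConvexBody K ∧
      w ≤ PoincareBall.minLassakWidth K ∧ ρ = PoincareBall.inradius K} 0 := by
  refine ⟨?_, fun b hb => le_of_forall_pos_le_add fun ε hε => ?_⟩
  · rintro _ ⟨K, -, -, rfl⟩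
    exact PoincareBall.inradius_nonneg K
  · obtain ⟨K, hK, hwK, hKε⟩ := PoincareBall.exists_isConvexBody_inradius_le hn w hε
    rw [zero_add]
    exact (hb ⟨K, hK, hwK, rfl⟩).trans hKε
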